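/- Let $G$ be a connected (possibly infinite) graph. A ray is a one-way infinite path. Two rays of $G$ are equivalent if for every finite vertex set $X$ both have a tail in the same component of $G-X$; the equivalence classes are the ends of $G$. The set $\Omega(G)$ of ends carries the topology generated by the sets of all ends whose rays have a tail in $C$, where $X$ ranges over the finite vertex sets and $C$ over the components of $G-X$. An end is undominated if no ray $R$ in it is dominated by a vertex $v$, i.e. if there is no infinite family of paths that start in $v$, have precisely their last vertex in $R-v$, and pairwise meet only in $v$. A finite-order separation of $G$ is a pair $\{A,B\}$ with $A\cup B=V(G)$, no edge between $A\setminus B$ and $B\setminus A$, and finite separator $A\cap B$; its orientations are $(A,B)$ and $(B,A)$, and $(A,B)\le (C,D)$ means $A\subseteq C$ and $B\supseteq D$. An $S_{\aleph_0}$-tree $(T,\alpha)$ is a tree $T$ with a map $\alpha$ from the oriented edges of $T$ to the oriented finite-order separations of $G$ that commutes with inversion and preserves the natural partial orders. An end $\omega$ of $G$ orients an edge $xy$ of $T$ from $x$ to $y$ if, for $\alpha(x,y)=(A,B)$, every ray in $\omega$ has a tail in $G[B]$. The end $\omega$ lives at a node $t$ of $T$ if it orients all edges at $t$ towards $t$,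 and corresponds to an end $\eta$ of $T$ if for some ray $t_0t_1\dots$ in $\eta$ it orients every edge $t_nt_{n+1}$ from $t_n$ to $t_{n+1}$. Let $\tau\colon\Omega(G)\to\Omega(T)\sqcup V(T)$ map each end of $G$ to the unique end or node of $T$ which it corresponds to or lives at. Then $(T,\alpha)$ displays $\Psi\subseteq\Omega(G)$ if $\tau$ restricts to a bijection $\Psi\to\Omega(T)$ and maps every end outside $\Psi$ to a node of $T$. Proposition 4.4. Let $G$ be a connected graph and let $\Psi\subseteq\Omega(G)$ be a non-empty and compact subspace that consists only of undominated ends. Then there exists an $S_{\aleph_0}$-tree $(T,\alpha)$ such that $T$ is locally finite, every separator $A\cap B$ of $(T,\alpha)$ induces a connected (in particular non-empty) subgraph of $G$, the separators at distinct edges of $T$ are disjoint, and $(T,\alpha)$ displays $\Psi$. -/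

import Mathlib

universe u v

namespace InfGraph

open SimpleGraph

section Rays

variable {V : Type u} {G : SimpleGraph V}

/-- A ray of `G`: a one-way infinite path `R 0, R 1, R 2, …` in `G`. -/
structure Ray (G : SimpleGraph V) where
  vert : ℕ → V
  injective : Function.Injective vert
  adj : ∀ n, G.Adj (vert n) (vert (n + 1))

/-- The ray `R` has a tail all of whose vertices lie in `S`, that is, a tail in `G[S]`. -/
def Ray.HasTailIn (R : Ray G) (S : Set V) : Prop :=
  ∃ n, ∀ m, n ≤ m → R.vert m ∈ S

/-- Two rays are equivalent if for every finite set `X` of vertices both have a tail in the same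
component of `G - X`. -/
def Ray.Equivalent (R R' : Ray G) : Prop :=
  ∀ X : Finset V, ∃ C : G.ComponentCompl (X : Set V),
    R.HasTailIn (C : Set V) ∧ R'.HasTailIn (C : Set V)

theorem Ray.HasTailIn.inter {R : Ray G} {S S' : Set V} (h : R.HasTailIn S)
    (h' : R.HasTailIn S') : R.HasTailIn (S ∩ S') := by
  obtain ⟨n, hn⟩ := h
  obtain ⟨n', hn'⟩ := h'
  exact ⟨max n n', fun m hm =>
    ⟨hn m ((le_max_left _ _).trans hm), hn' m ((le_max_right _ _).trans hm)⟩⟩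

theorem Ray.exists_component (R : Ray G) (X : Finset V) :
    ∃ C : G.ComponentCompl (X : Set V), R.HasTailIn (C : Set V) := by
  have hfin : {n | R.vert n ∈ (X : Set V)}.Finite :=
    X.finite_toSet.preimage R.injective.injOn
  obtain ⟨N, hN⟩ := hfin.bddAbove
  have hX : ∀ m, N + 1 ≤ m → R.vert m ∉ (X : Set V) := fun m hm hmem => by
    have h1 : m ≤ N := hN hmem
    omega
  refine ⟨G.componentComplMk (hX (N + 1) le_rfl), N + 1, fun m hm => ?_⟩
  induction m, hm using Nat.le_induction with
  | base => exact G.componentComplMk_mem _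
  | succ m hm ih =>
    exact ComponentCompl.mem_of_adj _ _ ih (hX _ (Nat.le_succ_of_le hm)) (R.adj m)

theorem Ray.component_unique {R : Ray G} {X : Finset V} {C D : G.ComponentCompl (X : Set V)}
    (hC : R.HasTailIn (C : Set V)) (hD : R.HasTailIn (D : Set V)) : C = D := by
  obtain ⟨n, hn⟩ := hC.inter hD
  by_contra hne
  exact Set.disjoint_iff.mp (ComponentCompl.pairwise_disjoint hne) (hn n le_rfl)

instance raySetoid (G : SimpleGraph V) : Setoid (Ray G) where
  r := Ray.Equivalent
  iseqv :=
    { refl := fun R X => by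
        obtain ⟨C, hC⟩ := R.exists_component X
        exact ⟨C, hC, hC⟩
      symm := fun h X => by
        obtain ⟨C, h1, h2⟩ := h X
        exact ⟨C, h2, h1⟩
      trans := fun h h' X => by
        obtain ⟨C, h1, h2⟩ := h X
        obtain ⟨D, h3, h4⟩ := h' X
        obtain rfl := Ray.component_unique h2 h3
        exact ⟨C, h1, h4⟩ }

/-- The ends of `G`: the equivalence classes of rays of `G`. -/
def GraphEnd (G : SimpleGraph V) : Type u :=
  Quotient (raySetoid G)

/-- The ray `R` belongs to the end `ω`. -/
def GraphEnd.HasRay (ω : GraphEnd G) (R : Ray G) : Prop :=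
  (Quotient.mk (raySetoid G) R : GraphEnd G) = ω

/-- Every ray of the end `ω` has a tail in `G[S]`. -/
def GraphEnd.LivesIn (ω : GraphEnd G) (S : Set V) : Prop :=
  ∀ R : Ray G, ω.HasRay R → R.HasTailIn S

/-- The topology of the end space. It is generated by the sets of all ends that live in `C`, where
`C` is a component of `G - X` and `X` is a finite set of vertices: this is the topology of the
inverse limit of the discrete spaces of components of `G - X`. -/
instance (G : SimpleGraph V) : TopologicalSpace (GraphEnd G) :=
  TopologicalSpace.generateFrom
    {U | ∃ (X : Finset V) (C : G.ComponentCompl (X : Set V)),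
      U = {ω : GraphEnd G | ω.LivesIn (C : Set V)}}

/-- The vertex `v` dominates the ray `R`: there is an infinite `v`–`(R - v)` fan in `G`, that is,
an infinite family of paths that start in `v`, have precisely their last vertex in `R - v`, and
pairwise meet only in `v`. -/
def Dominates (v : V) (R : Ray G) : Prop :=
  ∃ (b : ℕ → V) (P : ∀ n, G.Walk v (b n)),
    (∀ n, (P n).IsPath ∧ ∀ x ∈ (P n).support, x ∈ Set.range R.vert \ {v} ↔ x = b n) ∧
    ∀ m n, m ≠ n → ∀ x, x ∈ (P m).support → x ∈ (P n).support → x = v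

/-- No ray of the end `ω` is dominated by a vertex. -/
def GraphEnd.Undominated (ω : GraphEnd G) : Prop :=
  ∀ R : Ray G, ω.HasRay R → ∀ v : V, ¬ Dominates v R

end Rays

section Separations

variable {V : Type u}

/-- An oriented separation `(A, B)` of `G` of finite order. -/
@[ext]
structure FinSep (G : SimpleGraph V) where
  A : Set V
  B : Set V
  union_eq : A ∪ B = Set.univ
  no_edge : ∀ a ∈ A \ B, ∀ b ∈ B \ A, ¬ G.Adj a b
  finite_order : (A ∩ B).Finite

variable {G : SimpleGraph V}

/-- The inverse `(B, A)` of `(A, B)`. -/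
def FinSep.inv (s : FinSep G) : FinSep G where
  A := s.B
  B := s.A
  union_eq := by rw [Set.union_comm]; exact s.union_eq
  no_edge := fun a ha b hb h => s.no_edge b hb a ha h.symm
  finite_order := by rw [Set.inter_comm]; exact s.finite_order

/-- The partial order on oriented separations: `(A, B) ≤ (C, D)` if `A ⊆ C` and `D ⊆ B`. -/
instance : LE (FinSep G) where
  le s t := s.A ⊆ t.A ∧ t.B ⊆ s.B

/-- The separator `A ∩ B` of `(A, B)`. -/
def FinSep.separator (s : FinSep G) : Set V :=
  s.A ∩ s.B

end Separations

section Trees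

variable {V : Type u} {W : Type v} {G : SimpleGraph V} {T : SimpleGraph W}

/-- The natural partial order on the oriented edges of a tree: `(x, y) ≤ (z, w)` if the two agree
or if the tree contains a path `x, y, …, z, w` (where `y = z` is allowed). -/
def EdgeLE (d d' : T.Dart) : Prop :=
  d = d' ∨ ∃ p : T.Walk d.snd d'.fst, (Walk.cons d.adj (p.concat d'.adj)).IsPath

/-- An `S`-tree `(T, α)` for the set `S` of all finite-order separations of `G`: a tree `T` with a
map `α` from the oriented edges of `T` to the oriented finite-order separations of `G` that
commutes with inversion and preserves the partial order. -/
structure FinSepTree (G : SimpleGraph V) (T : SimpleGraph W) where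
  isTree : T.IsTree
  α : T.Dart → FinSep G
  map_symm : ∀ d, α d.symm = (α d).inv
  map_le : ∀ d d', EdgeLE d d' → α d ≤ α d'

/-- Via `α`, the end `ω` of `G` orients every edge of `T`, towards the side of the corresponding
separation that contains tails of all its rays: it chooses the orientation `d` if, for
`α d = (A, B)`, every ray of `ω` has a tail in `G[B]`. -/
def FinSepTree.Orients (𝒯 : FinSepTree G T) (ω : GraphEnd G) (d : T.Dart) : Prop :=
  ω.LivesIn (𝒯.α d).B

/-- The end `ω` lives at the node `t`: it orients all edges at `t` towards `t`. -/
def FinSepTree.LivesAt (𝒯 : FinSepTree G T) (ω : GraphEnd G) (t : W) : Prop :=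
  ∀ d : T.Dart, d.snd = t → 𝒯.Orients ω d

/-- The end `ω` corresponds to the end `η` of `T`: for some ray `t₀ t₁ …` in `η`, it orients each
edge `tₙ tₙ₊₁` from `tₙ` to `tₙ₊₁`. -/
def FinSepTree.CorrespondsTo (𝒯 : FinSepTree G T) (ω : GraphEnd G) (η : GraphEnd T) : Prop :=
  ∃ R : Ray T, η.HasRay R ∧ ∀ n, 𝒯.Orients ω ⟨(R.vert n, R.vert (n + 1)), R.adj n⟩

/-- `τ` is the map that takes each end of `G` to the end of `T` it corresponds to or to the node of
`T` it lives at, where precisely one end or node of `T` qualifies. -/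
def FinSepTree.IsEndMap (𝒯 : FinSepTree G T) (τ : GraphEnd G → GraphEnd T ⊕ W) : Prop :=
  (∀ ω η, τ ω = Sum.inl η ↔ 𝒯.CorrespondsTo ω η) ∧
  (∀ ω t, τ ω = Sum.inr t ↔ 𝒯.LivesAt ω t)

/-- `(T, α)` displays `Ψ`: the map `τ` restricts to a bijection from `Ψ` to the set of all ends of
`T`, and it takes every end outside `Ψ` to a node of `T`. -/
def FinSepTree.Displays (𝒯 : FinSepTree G T) (Ψ : Set (GraphEnd G)) : Prop :=
  ∃ τ : GraphEnd G → GraphEnd T ⊕ W, 𝒯.IsEndMap τ ∧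
    Set.BijOn τ Ψ (Set.range Sum.inl) ∧ ∀ ω, ω ∉ Ψ → τ ω ∈ Set.range Sum.inr

/-- Every node of `T` has finite degree. -/
def FinSepTree.IsLocallyFinite (_𝒯 : FinSepTree G T) : Prop :=
  ∀ t : W, (T.neighborSet t).Finite

/-- All separators of `(T, α)` induce connected (in particular, non-empty) subgraphs of `G`. -/
def FinSepTree.ConnectedSeparators (𝒯 : FinSepTree G T) : Prop :=
  ∀ d : T.Dart, (G.induce (𝒯.α d).separator).Connected

/-- The separators of `(T, α)` at distinct edges of `T` are disjoint. -/
def FinSepTree.DisjointSeparators (𝒯 : FinSepTree G T) : Prop :=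
  ∀ d d' : T.Dart, d.edge ≠ d'.edge → Disjoint (𝒯.α d).separator (𝒯.α d').separator

end Trees

end InfGraph

/-! The tree is grown by cutting `G` repeatedly along finite connected separators. Call a component
`C` of `G - X`, with `X` finite, a part if some end of `Ψ` lives in it. Since the ends of `Ψ` are
undominated and `Ψ` is compact, one finite `Z ⊇ X` makes the component of `G - Z` containing any
given end of `Ψ` send no edge to `X`. A finite connected `S C ⊆ C` containing `Z ∩ C` then separates
`X` from every end of `Ψ` in `C`: each such end lives in a component of `G - S C` inside `C`
(`exists_connected_finset_separating`). These components are the children of `C`, finitely many by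
compactness.

Iterating from `C = V(G)` and unfolding gives a locally finite rooted tree. The edge from a node's
parent to that node, with part `C`, receives the separation with separator `S C` that splits off the
children of `C`. Separators are disjoint because a child avoids the separator of its parent, while
siblings are disjoint.

The parts along a branch have empty intersection: a vertex in all of them would pass this property
on to its neighbours, hence to all of `G`, yet the first separator is non-empty and misses the
second part. So at most one end lives in all parts of a branch (`end_unique`), and compactness puts
one from `Ψ` there (`exists_end`). Hence branches match the ends of `Ψ`, and every other end gets
stuck at a node. -/

namespace InfGraph

open SimpleGraph

/-! ### Components, ends and finite-order separations -/

section EndLemmas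

variable {V : Type u} {G : SimpleGraph V}

/-- Connectedness of `K` in the form used throughout: walks inside `K` cannot leave a set closed
under adjacency in `K`. -/
theorem componentCompl_subset_of_closed {X : Set V} (K : G.ComponentCompl X) {U : Set V}
    (hne : ((K : Set V) ∩ U).Nonempty)
    (hU : ∀ a ∈ U, a ∈ (K : Set V) → ∀ b ∈ (K : Set V), G.Adj a b → b ∈ U) :
    (K : Set V) ⊆ U := by
  obtain ⟨a, ⟨ha, rfl⟩, haU⟩ := hne
  rintro b ⟨hb, hab⟩
  obtain ⟨p⟩ := ConnectedComponent.eq.mp hab.symm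
  have key : ∀ (x y : (Xᶜ : Set V)) (p : (G.induce Xᶜ).Walk x y),
      (x : V) ∈ (G.componentComplMk ha : Set V) → (x : V) ∈ U → (y : V) ∈ U := by
    intro x y p
    induction p with
    | nil => exact fun _ h => h
    | @cons x z y h p ih =>
      intro hx hxU
      have hz : (z : V) ∈ (G.componentComplMk ha : Set V) :=
        ComponentCompl.mem_of_adj _ _ hx z.2 h
      exact ih hz (hU _ hxU hx _ hz h)
  exact key _ _ p (G.componentComplMk_mem ha) haU

theorem exists_walk_of_mem_componentCompl {X : Set V} {K : G.ComponentCompl X} {a b : V}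
    (ha : a ∈ (K : Set V)) (hb : b ∈ (K : Set V)) :
    ∃ p : G.Walk a b, ∀ x ∈ p.support, x ∈ (K : Set V) := by
  have := componentCompl_subset_of_closed K
    (U := {b | ∃ p : G.Walk a b, ∀ x ∈ p.support, x ∈ (K : Set V)})
    ⟨a, ha, Walk.nil, by simpa using ha⟩ ?_
  · exact this hb
  · rintro c ⟨p, hp⟩ - d hd hcd
    refine ⟨p.concat hcd, fun x hx => ?_⟩
    rw [Walk.support_concat] at hx
    simp only [List.mem_append, List.mem_singleton] at hx
    rcases hx with hx | rfl
    · exact hp x hx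
    · exact hd

theorem exists_connected_finset_of_componentCompl {X : Set V} (K : G.ComponentCompl X)
    (t : Finset V) (ht : (t : Set V) ⊆ K) :
    ∃ S : Finset V, t ⊆ S ∧ (S : Set V) ⊆ K ∧ (G.induce (S : Set V)).Connected := by
  classical
  obtain ⟨u, hu⟩ := K.nonempty
  have hw := fun v : t => exists_walk_of_mem_componentCompl hu (ht v.2)
  choose p hp using hw
  have hpS : ∀ v : t, {x | x ∈ (p v).support} ⊆
      ((insert u (t.attach.biUnion fun v => (p v).support.toFinset) : Finset V) : Set V) :=
    fun v x hx => by
      simp only [Finset.coe_insert, Finset.coe_biUnion, Set.mem_insert_iff, Set.mem_iUnion]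
      exact Or.inr ⟨v, by simp, by simpa using hx⟩
  refine ⟨insert u (t.attach.biUnion fun v => (p v).support.toFinset), fun v hv => ?_,
    fun x hx => ?_, ?_⟩
  · exact hpS ⟨v, hv⟩ (p ⟨v, hv⟩).end_mem_support
  · rw [Finset.mem_coe, Finset.mem_insert, Finset.mem_biUnion] at hx
    rcases hx with rfl | ⟨v, -, hx⟩
    · exact hu
    · exact hp v x (List.mem_toFinset.mp hx)
  · refine G.induce_connected_of_patches u (by simp) fun {x} hx => ?_
    rw [Finset.mem_coe, Finset.mem_insert, Finset.mem_biUnion] at hx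
    rcases hx with rfl | ⟨v, -, hx⟩
    · exact ⟨{x}, by simp, rfl, rfl, Reachable.refl _⟩
    · exact ⟨{x | x ∈ (p v).support}, hpS v, (p v).start_mem_support, List.mem_toFinset.mp hx,
        (p v).connected_induce_support.preconnected _ _⟩

theorem Ray.HasTailIn.mono {R : Ray G} {S S' : Set V} (h : R.HasTailIn S) (hS : S ⊆ S') :
    R.HasTailIn S' := by
  obtain ⟨n, hn⟩ := h
  exact ⟨n, fun m hm => hS (hn m hm)⟩

theorem GraphEnd.LivesIn.mono {ω : GraphEnd G} {S S' : Set V} (h : ω.LivesIn S) (hS : S ⊆ S') :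
    ω.LivesIn S' := fun R hR => (h R hR).mono hS

theorem GraphEnd.LivesIn.inter {ω : GraphEnd G} {S S' : Set V} (h : ω.LivesIn S)
    (h' : ω.LivesIn S') : ω.LivesIn (S ∩ S') := fun R hR => (h R hR).inter (h' R hR)

theorem GraphEnd.exists_ray (ω : GraphEnd G) : ∃ R, ω.HasRay R := Quotient.exists_rep ω

theorem GraphEnd.livesIn_component {ω : GraphEnd G} {R : Ray G} (hR : ω.HasRay R) {X : Finset V}
    {C : G.ComponentCompl (X : Set V)} (hC : R.HasTailIn (C : Set V)) :
    ω.LivesIn (C : Set V) := by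
  intro R' hR'
  have hRR' : Ray.Equivalent R R' := Quotient.exact (hR.trans hR'.symm)
  obtain ⟨D, hD, hD'⟩ := hRR' X
  obtain rfl := Ray.component_unique hC hD
  exact hD'

theorem GraphEnd.exists_component (ω : GraphEnd G) (X : Finset V) :
    ∃ C : G.ComponentCompl (X : Set V), ω.LivesIn (C : Set V) := by
  obtain ⟨R, hR⟩ := ω.exists_ray
  obtain ⟨C, hC⟩ := R.exists_component X
  exact ⟨C, livesIn_component hR hC⟩

theorem GraphEnd.LivesIn.nonempty {ω : GraphEnd G} {S : Set V} (h : ω.LivesIn S) :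
    S.Nonempty := by
  obtain ⟨R, hR⟩ := ω.exists_ray
  obtain ⟨n, hn⟩ := h R hR
  exact ⟨_, hn n le_rfl⟩

theorem GraphEnd.not_livesIn_finset {ω : GraphEnd G} (X : Finset V) : ¬ ω.LivesIn (X : Set V) := by
  intro h
  obtain ⟨C, hC⟩ := ω.exists_component X
  obtain ⟨x, hx, hx'⟩ := (h.inter hC).nonempty
  exact ComponentCompl.notMem_of_mem hx' hx

theorem GraphEnd.component_unique {ω : GraphEnd G} {X : Finset V}
    {C D : G.ComponentCompl (X : Set V)} (hC : ω.LivesIn (C : Set V))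
    (hD : ω.LivesIn (D : Set V)) : C = D := by
  obtain ⟨R, hR⟩ := ω.exists_ray
  exact Ray.component_unique (hC R hR) (hD R hR)

theorem GraphEnd.eq_of_forall_component {ω ω' : GraphEnd G}
    (h : ∀ X : Finset V, ∃ C : G.ComponentCompl (X : Set V),
      ω.LivesIn (C : Set V) ∧ ω'.LivesIn (C : Set V)) : ω = ω' := by
  obtain ⟨R, hR⟩ := ω.exists_ray
  obtain ⟨R', hR'⟩ := ω'.exists_ray
  rw [← hR, ← hR']
  refine Quotient.sound fun X => ?_
  obtain ⟨C, h1, h2⟩ := h X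
  exact ⟨C, h1 R hR, h2 R' hR'⟩

theorem isOpen_livesIn {X : Finset V} (C : G.ComponentCompl (X : Set V)) :
    IsOpen {ω : GraphEnd G | ω.LivesIn (C : Set V)} :=
  TopologicalSpace.isOpen_generateFrom_of_mem ⟨X, C, rfl⟩

/-- The complement is the union of the basic open sets of the other components of `G - X`, so basic
open sets are clopen. -/
theorem isOpen_not_livesIn {X : Finset V} (C : G.ComponentCompl (X : Set V)) :
    IsOpen {ω : GraphEnd G | ¬ ω.LivesIn (C : Set V)} := by
  have : {ω : GraphEnd G | ¬ ω.LivesIn (C : Set V)} =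
      ⋃ D ∈ {D : G.ComponentCompl (X : Set V) | D ≠ C},
        {ω : GraphEnd G | ω.LivesIn (D : Set V)} := by
    ext ω
    simp only [Set.mem_ofPred_eq, Set.mem_iUnion, exists_prop]
    constructor
    · intro h
      obtain ⟨D, hD⟩ := ω.exists_component X
      exact ⟨D, fun hDC => h (hDC ▸ hD), hD⟩
    · rintro ⟨D, hne, hD⟩ hC
      exact hne (GraphEnd.component_unique hD hC)
  rw [this]
  exact isOpen_biUnion fun D _ => isOpen_livesIn D

/-- The component of the end off the separator has no edge across the separation, so it lies on one
side. -/
theorem FinSep.livesIn_or (s : FinSep G) (ω : GraphEnd G) : ω.LivesIn s.A ∨ ω.LivesIn s.B := by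
  obtain ⟨C, hC⟩ := ω.exists_component s.finite_order.toFinset
  have hdisj : ∀ x ∈ (C : Set V), ¬ (x ∈ s.A ∧ x ∈ s.B) := fun x hx hAB =>
    ComponentCompl.notMem_of_mem hx (by simpa using hAB)
  have hun : ∀ x, x ∈ s.A ∨ x ∈ s.B := fun x => by
    have := Set.mem_univ x
    rwa [← s.union_eq] at this
  by_cases h : ((C : Set V) ∩ s.A).Nonempty
  · refine Or.inl (hC.mono (componentCompl_subset_of_closed C h fun a haA haC b hbC hab => ?_))
    by_contra hbA
    exact s.no_edge a ⟨haA, fun haB => hdisj a haC ⟨haA, haB⟩⟩ b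
      ⟨(hun b).resolve_left hbA, hbA⟩ hab
  · exact Or.inr (hC.mono fun x hx => (hun x).resolve_left fun hxA => h ⟨x, hx, hxA⟩)

theorem FinSep.not_livesIn_both (s : FinSep G) (ω : GraphEnd G) (hA : ω.LivesIn s.A)
    (hB : ω.LivesIn s.B) : False := by
  apply GraphEnd.not_livesIn_finset (ω := ω) s.finite_order.toFinset
  simpa using hA.inter hB

/-! ### Domination and fans -/

theorem exists_walk_first_hit (B : Set V) {u v : V} (p : G.Walk u v) (hv : v ∈ B) :
    ∃ b, b ∈ B ∧ ∃ q : G.Walk u b, q.support ⊆ p.support ∧ ∀ z ∈ q.support, z ∈ B → z = b := by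
  induction p with
  | nil => exact ⟨_, hv, Walk.nil, by simp, by simp⟩
  | @cons u w v h p ih =>
    by_cases hu : u ∈ B
    · exact ⟨u, hu, Walk.nil, by simp, by simp⟩
    · obtain ⟨b, hb, q, hq, hqB⟩ := ih hv
      refine ⟨b, hb, Walk.cons h q, ?_, ?_⟩
      · rw [Walk.support_cons, Walk.support_cons]
        exact List.cons_subset_cons _ hq
      · intro z hz hzB
        rw [Walk.support_cons, List.mem_cons] at hz
        rcases hz with rfl | hz
        · exact absurd hzB hu
        · exact hqB z hz hzB

/-- The fan is built greedily: with `Y` the vertices used so far other than `x`, the component of `G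
- Y` containing `x` also contains a tail of `R`, hence a further path from `x` to `R` that avoids
`Y`. -/
theorem dominates_of_forall_mem_component {ω : GraphEnd G} {R : Ray G} (hR : ω.HasRay R) {x : V}
    (h : ∀ (Y : Finset V) (C : G.ComponentCompl (Y : Set V)), x ∉ Y → ω.LivesIn (C : Set V) →
      x ∈ (C : Set V)) : Dominates x R := by
  classical
  obtain ⟨f, hf, hr⟩ := exists_seq_of_forall_finset_exists
    (α := Σ b : V, G.Walk x b)
    (fun q => q.2.IsPath ∧ ∀ z ∈ q.2.support, z ∈ Set.range R.vert \ {x} ↔ z = q.1)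
    (fun q q' => ∀ z, z ∈ q.2.support → z ∈ q'.2.support → z = x) (by
      intro s _
      let Y : Finset V := (s.biUnion fun q => q.2.support.toFinset).erase x
      obtain ⟨C, hC⟩ := ω.exists_component Y
      have hx : x ∈ (C : Set V) := h Y C (by simp [Y]) hC
      obtain ⟨n, hn⟩ := hC R hR
      -- The vertex `x` may itself lie on `R`; of two consecutive vertices of the tail at least one
      -- differs from it.
      obtain ⟨m, hm, hmx⟩ : ∃ m, n ≤ m ∧ R.vert m ≠ x := by
        by_cases h0 : R.vert n = x
        · exact ⟨n + 1, by omega, fun h1 => by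
            have := R.injective (h0.trans h1.symm); omega⟩
        · exact ⟨n, le_rfl, h0⟩
      obtain ⟨p, hp⟩ := exists_walk_of_mem_componentCompl hx (hn m hm)
      obtain ⟨b, hb, q, hqp, hqb⟩ := exists_walk_first_hit (Set.range R.vert \ {x}) p
        ⟨⟨m, rfl⟩, hmx⟩
      refine ⟨⟨b, q.bypass⟩, ⟨q.bypass_isPath, fun z hz => ⟨fun hzB =>
        hqb z (q.support_bypass_subset_support hz) hzB, fun hzb => ?_⟩⟩, ?_⟩
      · exact hzb ▸ hb
      · intro q' hq' z hz hz'
        by_contra hzx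
        refine ComponentCompl.notMem_of_mem (hp z (hqp (q.support_bypass_subset_support hz'))) ?_
        simp only [Y, Finset.coe_erase, Set.mem_sdiff, Finset.mem_coe, Finset.mem_biUnion,
          List.mem_toFinset, Set.mem_singleton_iff]
        exact ⟨⟨q', hq', hz⟩, hzx⟩)
  refine ⟨fun n => (f n).1, fun n => (f n).2, hf, fun m n hmn z hz hz' => ?_⟩
  rcases lt_or_gt_of_ne hmn with hlt | hlt
  · exact hr m n hlt z hz hz'
  · exact hr n m hlt z hz' hz

/-- Each `x` is cut off from `ω` by a finite `Y x` not containing `x`. Deleting all `Y x` with `x ∈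
X` as well as `X` works: an edge from `x` to the remaining component would pull `x` into the
component of `G - Y x` in which `ω` lives. -/
theorem GraphEnd.Undominated.exists_finset_not_adj {ω : GraphEnd G} (hω : ω.Undominated)
    (X : Finset V) : ∃ Z : Finset V, X ⊆ Z ∧ ∃ C : G.ComponentCompl (Z : Set V),
      ω.LivesIn (C : Set V) ∧ ∀ x ∈ X, ∀ c ∈ (C : Set V), ¬ G.Adj x c := by
  classical
  obtain ⟨R, hR⟩ := ω.exists_ray
  have h : ∀ x : V, ∃ (Y : Finset V) (C : G.ComponentCompl (Y : Set V)), x ∉ Y ∧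
      ω.LivesIn (C : Set V) ∧ x ∉ (C : Set V) := by
    intro x
    by_contra! hcon
    exact hω R hR x (dominates_of_forall_mem_component hR hcon)
  choose Y D hxY hD hxD using h
  let Z := X ∪ X.biUnion Y
  obtain ⟨C, hC⟩ := ω.exists_component Z
  refine ⟨Z, Finset.subset_union_left, C, hC, fun x hx c hc hadj => hxD x ?_⟩
  have hYZ : ((Y x : Finset V) : Set V) ⊆ Z := Finset.coe_subset.mpr
    ((Finset.subset_biUnion_of_mem Y hx).trans Finset.subset_union_right)
  have hCD : C.hom hYZ = D x := component_unique (hC.mono (C.subset_hom hYZ)) (hD x)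
  exact ComponentCompl.mem_of_adj c x (hCD ▸ C.subset_hom hYZ hc) (hxY x) hadj.symm

/-! ### Compact sets of undominated ends -/

variable {Ψ : Set (GraphEnd G)}

theorem exists_finset_forall_not_adj (hcpt : IsCompact Ψ) (hund : ∀ ω ∈ Ψ, ω.Undominated)
    (X : Finset V) : ∃ Z : Finset V, X ⊆ Z ∧ ∀ ω ∈ Ψ, ∀ C : G.ComponentCompl (Z : Set V),
      ω.LivesIn (C : Set V) → ∀ x ∈ X, ∀ c ∈ (C : Set V), ¬ G.Adj x c := by
  classical
  have h := fun ω : Ψ => (hund ω ω.2).exists_finset_not_adj X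
  choose Z hXZ C hC hadj using h
  obtain ⟨t, ht⟩ := hcpt.elim_finite_subcover
    (fun ω : Ψ => {ω' : GraphEnd G | ω'.LivesIn (C ω : Set V)}) (fun ω => isOpen_livesIn (C ω))
    (fun ω hω => Set.mem_iUnion.mpr ⟨⟨ω, hω⟩, hC ⟨ω, hω⟩⟩)
  refine ⟨X ∪ t.biUnion Z, Finset.subset_union_left, fun ω hω D hD x hx c hc => ?_⟩
  obtain ⟨i, hi, hωi⟩ := Set.mem_iUnion₂.mp (ht hω)
  have hZ : ((Z i : Finset V) : Set V) ⊆ (X ∪ t.biUnion Z : Finset V) := Finset.coe_subset.mpr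
    ((Finset.subset_biUnion_of_mem Z hi).trans Finset.subset_union_right)
  have hDC : D.hom hZ = C i := GraphEnd.component_unique (hD.mono (D.subset_hom hZ)) hωi
  exact hadj i x hx c (hDC ▸ D.subset_hom hZ hc)

theorem exists_connected_finset_separating (hcpt : IsCompact Ψ)
    (hund : ∀ ω ∈ Ψ, ω.Undominated) {X : Finset V} (K : G.ComponentCompl (X : Set V)) :
    ∃ S : Finset V, (S : Set V) ⊆ K ∧ (G.induce (S : Set V)).Connected ∧
      ∀ ω ∈ Ψ, ω.LivesIn (K : Set V) →
        ∃ D : G.ComponentCompl (S : Set V), (D : Set V) ⊆ K ∧ ω.LivesIn (D : Set V) := by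
  classical
  obtain ⟨Z, hXZ, hZ⟩ := exists_finset_forall_not_adj hcpt hund X
  obtain ⟨S, hZS, hSK, hS⟩ := exists_connected_finset_of_componentCompl K
    (Z.filter (· ∈ (K : Set V))) (by intro x hx; simpa using (Finset.mem_filter.mp hx).2)
  refine ⟨S, hSK, hS, fun ω hω hωK => ?_⟩
  obtain ⟨D, hD⟩ := ω.exists_component S
  obtain ⟨E, hE⟩ := ω.exists_component (Z ∪ S)
  obtain ⟨E', hE'⟩ := ω.exists_component Z
  have hZZ : (Z : Set V) ⊆ (Z ∪ S : Finset V) := Finset.coe_subset.mpr Finset.subset_union_left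
  have hEE' : (E : Set V) ⊆ E' :=
    (E.hom_eq_iff_le hZZ E').mp (GraphEnd.component_unique (hE.mono (E.subset_hom hZZ)) hE')
  have hEK : (E : Set V) ⊆ K :=
    have hX : (X : Set V) ⊆ (Z ∪ S : Finset V) := (Finset.coe_subset.mpr hXZ).trans hZZ
    (E.hom_eq_iff_le hX K).mp (GraphEnd.component_unique (hE.mono (E.subset_hom hX)) hωK)
  refine ⟨D, Set.Subset.trans ?_ hEK, hD⟩
  -- `D` cannot leave `E`: the first vertex `b` outside would lie in `Z` but not in `S`, hence
  -- outside `K` and so in `X`, whereas `E ⊆ E'` has no neighbour in `X`.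
  refine componentCompl_subset_of_closed D (hD.inter hE).nonempty fun a haE _ b hbD hab => ?_
  refine ComponentCompl.mem_of_adj a b haE (fun hb => ?_) hab
  have hbS : b ∉ S := ComponentCompl.notMem_of_mem hbD
  have hbZ : b ∈ Z := by simpa [hbS] using hb
  have hbK : b ∉ (K : Set V) := fun hbK => hbS (hZS (Finset.mem_filter.mpr ⟨hbZ, hbK⟩))
  have hbX : b ∈ X := by
    by_contra hbX
    exact hbK (ComponentCompl.mem_of_adj a b (hEK haE) hbX hab)
  exact hZ ω hω E' hE' b hbX a (hEE' haE) hab.symm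

/-- The sets of ends living in distinct components are disjoint, so a finite subcover must contain
every component that some end of `Ψ` uses. -/
theorem finite_setOf_component_livesIn (hcpt : IsCompact Ψ) (S : Finset V) :
    {D : G.ComponentCompl (S : Set V) | ∃ ω ∈ Ψ, ω.LivesIn (D : Set V)}.Finite := by
  obtain ⟨t, ht⟩ := hcpt.elim_finite_subcover
    (fun D : G.ComponentCompl (S : Set V) => {ω : GraphEnd G | ω.LivesIn (D : Set V)})
    (fun D => isOpen_livesIn D)
    (fun ω _ => Set.mem_iUnion.mpr (ω.exists_component S))
  refine t.finite_toSet.subset ?_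
  rintro D ⟨ω, hω, hD⟩
  obtain ⟨i, hi, hωi⟩ := Set.mem_iUnion₂.mp (ht hω)
  exact GraphEnd.component_unique hD hωi ▸ hi

/-- Otherwise the increasing open sets of ends not living in `C n` cover `Ψ`, and by compactness a
single one does. -/
theorem exists_end_livesIn_chain (hcpt : IsCompact Ψ) (C : ℕ → Set V)
    (hC : ∀ n, ∃ (X : Finset V) (K : G.ComponentCompl (X : Set V)), (K : Set V) = C n)
    (hmono : Antitone C) (hne : ∀ n, ∃ ω ∈ Ψ, ω.LivesIn (C n)) :
    ∃ ω ∈ Ψ, ∀ n, ω.LivesIn (C n) := by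
  by_contra! hcon
  obtain ⟨n, hn⟩ := hcpt.elim_directed_cover (fun n => {ω : GraphEnd G | ¬ ω.LivesIn (C n)})
    (fun n => by
      obtain ⟨X, K, hK⟩ := hC n
      simpa only [hK] using isOpen_not_livesIn K)
    (fun ω hω => Set.mem_iUnion.mpr (hcon ω hω))
    (directed_of_isDirected_le fun m n hmn ω hω h => hω (h.mono (hmono hmn)))
  obtain ⟨ω, hω, hlive⟩ := hne n
  exact hn hω hlive

theorem end_unique_of_iInter_empty {C : ℕ → Set V}
    (hC : ∀ n, ∃ (X : Finset V) (K : G.ComponentCompl (X : Set V)), (K : Set V) = C n)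
    (hmono : Antitone C) (hempty : ∀ v, ∃ n, v ∉ C n) {ω ω' : GraphEnd G}
    (hω : ∀ n, ω.LivesIn (C n)) (hω' : ∀ n, ω'.LivesIn (C n)) : ω = ω' := by
  refine GraphEnd.eq_of_forall_component fun X => ?_
  choose N hN using hempty
  -- From this index on, `C n` misses the finite set `X`; being connected, it lies in one component
  -- of `G - X`.
  let n := X.sup N
  have hX : ∀ x ∈ X, x ∉ C n := fun x hx h => hN x (hmono (Finset.le_sup hx) h)
  obtain ⟨D, hD⟩ := ω.exists_component X
  obtain ⟨Y, K, hK⟩ := hC n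
  have hCD : C n ⊆ D := by
    rw [← hK]
    refine componentCompl_subset_of_closed K ?_ fun a haD _ b hbK hab =>
      ComponentCompl.mem_of_adj a b haD (fun hb => hX b hb (hK ▸ hbK)) hab
    rw [hK]
    exact ((hω n).inter hD).nonempty
  exact ⟨D, hD, (hω' n).mono hCD⟩

end EndLemmas

end InfGraph

namespace InfGraph

open SimpleGraph

/-! ### Rays with a common tail -/

theorem Ray.equivalent_of_eventually_eq {V : Type u} {G : SimpleGraph V} {R R' : Ray G}
    (m n : ℕ) (h : ∀ k, R.vert (m + k) = R'.vert (n + k)) : Ray.Equivalent R R' := by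
  intro X
  obtain ⟨C, N, hN⟩ := R.exists_component X
  refine ⟨C, ⟨N, hN⟩, n + N, fun j hj => ?_⟩
  obtain ⟨k, rfl⟩ := Nat.exists_eq_add_of_le (show n ≤ j by omega)
  rw [← h]
  exact hN _ (by omega)

/-- The tail of a ray from its `n`-th vertex on. -/
def Ray.tail {V : Type u} {G : SimpleGraph V} (R : Ray G) (n : ℕ) : Ray G where
  vert k := R.vert (n + k)
  injective := R.injective.comp (add_right_injective n)
  adj k := R.adj (n + k)

theorem GraphEnd.HasRay.tail {V : Type u} {G : SimpleGraph V} {η : GraphEnd G} {R : Ray G}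
    (h : η.HasRay R) (n : ℕ) : η.HasRay (R.tail n) :=
  (Quotient.sound (Ray.equivalent_of_eventually_eq 0 n fun k => by simp [Ray.tail])).trans h

/-! ### Unfolding a relation into a rooted tree; the suffix relation is the ancestor order -/

section BranchTree

variable {α : Type u}

/-- `l` lists, from its last entry to its head, a sequence of successive children starting at a
child of `r`. -/
def IsBranch (r : α) (Child : α → α → Prop) : List α → Prop
  | [] => True
  | a :: l => Child (l.headD r) a ∧ IsBranch r Child l

/-- The nodes of the rooted tree unfolding the relation `Child` from `r`. -/
def Branch (r : α) (Child : α → α → Prop) : Type u :=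
  {l : List α // IsBranch r Child l}

variable {r : α} {Child : α → α → Prop}

namespace Branch

/-- The label of a node. -/
def top (x : Branch r Child) : α := x.1.headD r

/-- The root. -/
def root : Branch r Child := ⟨[], trivial⟩

/-- The node `x` is the parent of the node `y`. -/
def IsParent (x y : Branch r Child) : Prop := ∃ a, y.1 = a :: x.1

theorem IsParent.child {x y : Branch r Child} (h : x.IsParent y) : Child x.top y.top := by
  obtain ⟨a, ha⟩ := h
  have := y.2
  rw [ha] at this
  simpa [top, ha] using this.1

theorem IsParent.length {x y : Branch r Child} (h : x.IsParent y) :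
    y.1.length = x.1.length + 1 := by
  obtain ⟨a, ha⟩ := h
  simp [ha]

theorem IsParent.unique {x x' y : Branch r Child} (h : x.IsParent y) (h' : x'.IsParent y) :
    x = x' := by
  obtain ⟨a, ha⟩ := h
  obtain ⟨b, hb⟩ := h'
  exact Subtype.ext (List.cons.inj (ha.symm.trans hb)).2

theorem IsParent.eq_of_top_eq {x y y' : Branch r Child} (h : x.IsParent y) (h' : x.IsParent y')
    (ht : y.top = y'.top) : y = y' := by
  obtain ⟨a, ha⟩ := h
  obtain ⟨b, hb⟩ := h'
  simp only [top, ha, hb, List.headD_cons] at ht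
  exact Subtype.ext (by rw [ha, hb, ht])

theorem IsParent.suffix {x y : Branch r Child} (h : x.IsParent y) : x.1 <:+ y.1 := by
  obtain ⟨a, ha⟩ := h
  exact ha ▸ List.suffix_cons a x.1

theorem exists_isParent_of_child {x : Branch r Child} {a : α} (h : Child x.top a) :
    ∃ y : Branch r Child, x.IsParent y ∧ y.top = a :=
  ⟨⟨a :: x.1, h, x.2⟩, ⟨a, rfl⟩, rfl⟩

theorem eq_root_or_exists_isParent (y : Branch r Child) :
    y = root ∨ ∃ x : Branch r Child, x.IsParent y := by
  obtain ⟨l, hl⟩ := y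
  cases l with
  | nil => exact Or.inl rfl
  | cons a l => exact Or.inr ⟨⟨l, hl.2⟩, a, rfl⟩

theorem not_isParent_root {x : Branch r Child} : ¬ x.IsParent root := by
  rintro ⟨a, ha⟩
  exact List.cons_ne_nil _ _ ha.symm

theorem induction_on {P : Branch r Child → Prop} (h0 : P root)
    (h1 : ∀ x y : Branch r Child, x.IsParent y → P x → P y) (y : Branch r Child) : P y := by
  obtain ⟨l, hl⟩ := y
  induction l with
  | nil => exact h0
  | cons a l ih => exact h1 ⟨l, hl.2⟩ _ ⟨a, rfl⟩ (ih hl.2)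

theorem suffix_isParent {x y z : Branch r Child} (h : y.IsParent z) (hx : x.1 <:+ z.1) :
    x = z ∨ x.1 <:+ y.1 := by
  obtain ⟨a, ha⟩ := h
  rw [ha, List.suffix_cons_iff, ← ha] at hx
  exact hx.imp_left fun h => Subtype.ext h

theorem exists_isParent_suffix {x z : Branch r Child} (hx : x.1 <:+ z.1) (hne : x ≠ z) :
    ∃ y : Branch r Child, x.IsParent y ∧ y.1 <:+ z.1 := by
  induction z using induction_on with
  | h0 => exact absurd (Subtype.ext (List.suffix_nil.mp hx)) hne
  | h1 y z h ih =>
    have hxy := (suffix_isParent h hx).resolve_left hne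
    by_cases hxy' : x = y
    · exact ⟨z, hxy' ▸ h, List.suffix_rfl⟩
    · obtain ⟨w, hw, hwy⟩ := ih hxy hxy'
      exact ⟨w, hw, hwy.trans h.suffix⟩

/-- The rooted tree unfolding the relation `Child` from `r`. -/
def tree (r : α) (Child : α → α → Prop) : SimpleGraph (Branch r Child) where
  Adj x y := x.IsParent y ∨ y.IsParent x
  symm := ⟨fun _ _ h => h.symm⟩
  loopless := ⟨fun x h => by
    have := (or_self_iff.mp h).length
    omega⟩

theorem tree_connected : (tree r Child).Connected := by
  rw [connected_iff_exists_forall_reachable]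
  refine ⟨root, fun y => ?_⟩
  induction y using induction_on with
  | h0 => exact Reachable.refl _
  | h1 x y h ih => exact ih.trans (Adj.reachable (Or.inl h))

/-- The descendants of `x` can be left only from `x` itself. -/
theorem suffix_of_adj {x a b : Branch r Child} (hx : x.1 <:+ a.1) (hne : a ≠ x)
    (hab : (tree r Child).Adj a b) : x.1 <:+ b.1 := by
  rcases hab with h | h
  · exact hx.trans h.suffix
  · exact (suffix_isParent h hx).resolve_left hne.symm

theorem tree_isAcyclic : (tree r Child).IsAcyclic := by
  rw [isAcyclic_iff_forall_adj_isBridge]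
  have key : ∀ x y : Branch r Child, x.IsParent y → (tree r Child).IsBridge s(y, x) := by
    intro x y h
    rw [isBridge_iff]
    rintro ⟨p⟩
    -- Without the edge from `y` to its parent `x`, a walk starting below `y` stays below `y`, so it
    -- never reaches `x`.
    have : ∀ (a b : Branch r Child) (p : ((tree r Child).deleteEdges {s(y, x)}).Walk a b),
        y.1 <:+ a.1 → y.1 <:+ b.1 := by
      intro a b p
      induction p with
      | nil => exact id
      | @cons a b c hab p ih =>
        intro ha
        refine ih ?_
        rw [deleteEdges_adj] at hab
        by_cases hay : a = y
        · subst hay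
          rcases hab.1 with h' | h'
          · exact h'.suffix
          · exact absurd (by rw [h'.unique h]; rfl) hab.2
        · exact suffix_of_adj ha hay hab.1
    have hyx := (this y x p List.suffix_rfl).length_le
    have := h.length
    omega
  rintro x y (h | h)
  · rw [Sym2.eq_swap]
    exact key x y h
  · exact key y x h

theorem tree_isTree : (tree r Child).IsTree := ⟨tree_connected, tree_isAcyclic⟩

/-- Depth cannot decrease forever, and after one step away from the root a step back would revisit
the unique parent. -/
theorem ray_eventually_isParent (R : Ray (tree r Child)) :
    ∃ N, ∀ k, N ≤ k → (R.vert k).IsParent (R.vert (k + 1)) := by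
  have hex : ∃ N, (R.vert N).IsParent (R.vert (N + 1)) := by
    by_contra! hcon
    have hlen : ∀ k, (R.vert k).1.length + k = (R.vert 0).1.length := by
      intro k
      induction k with
      | zero => rfl
      | succ k ih =>
        have := ((R.adj k).resolve_left (hcon k)).length
        omega
    have := hlen ((R.vert 0).1.length + 1)
    omega
  obtain ⟨N, hN⟩ := hex
  refine ⟨N, fun k hk => ?_⟩
  induction k, hk using Nat.le_induction with
  | base => exact hN
  | succ k hk ih =>
    refine (R.adj (k + 1)).resolve_right fun h => ?_
    have := R.injective (ih.unique h)
    omega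

theorem suffix_of_le {c : ℕ → Branch r Child} (h : ∀ n, (c n).IsParent (c (n + 1))) {m n : ℕ}
    (hmn : m ≤ n) : (c m).1 <:+ (c n).1 := by
  induction n, hmn using Nat.le_induction with
  | base => exact List.suffix_rfl
  | succ n hn ih => exact ih.trans (h n).suffix

theorem length_chain {c : ℕ → Branch r Child} (h : ∀ n, (c n).IsParent (c (n + 1))) (n : ℕ) :
    (c n).1.length = (c 0).1.length + n := by
  induction n with
  | zero => rfl
  | succ n ih => rw [(h n).length, ih, add_assoc]

theorem eq_of_suffix_of_length_eq {x y : Branch r Child} (h : x.1 <:+ y.1 ∨ y.1 <:+ x.1)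
    (hl : x.1.length = y.1.length) : x = y :=
  h.elim (fun h => Subtype.ext (h.eq_of_length hl))
    fun h => (Subtype.ext (h.eq_of_length hl.symm)).symm

/-- A sequence of nodes each of which is the parent of the next is a ray. -/
def rayOfChain (c : ℕ → Branch r Child) (h : ∀ n, (c n).IsParent (c (n + 1))) :
    Ray (tree r Child) where
  vert := c
  injective m n hmn := by
    have hm := length_chain h m
    have hn := length_chain h n
    rw [hmn] at hm
    omega
  adj n := Or.inl (h n)

theorem hasTailIn_descendants_of_equivalent {R R' : Ray (tree r Child)} (h : Ray.Equivalent R R')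
    (x : Branch r Child) (hR : R.HasTailIn {y | x.1 <:+ y.1}) :
    R'.HasTailIn {y | x.1 <:+ y.1} := by
  obtain ⟨C, hC, hC'⟩ := h {x}
  refine hC'.mono (componentCompl_subset_of_closed C ?_ fun a ha haC b _ hab =>
    suffix_of_adj ha (fun hax => ComponentCompl.notMem_of_mem haC (by simp [hax])) hab)
  obtain ⟨n, hn⟩ := hC.inter hR
  exact ⟨_, hn n le_rfl⟩

/-- Equivalent rays eventually lie below the same nodes, and two ancestors of one node at equal
depth coincide. -/
theorem chain_eq_of_equivalent {c c' : ℕ → Branch r Child}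
    (h : ∀ n, (c n).IsParent (c (n + 1))) (h' : ∀ n, (c' n).IsParent (c' (n + 1)))
    (h0 : c 0 = root) (h0' : c' 0 = root)
    (heq : Ray.Equivalent (rayOfChain c h) (rayOfChain c' h')) : c = c' := by
  funext n
  obtain ⟨N, hN⟩ := hasTailIn_descendants_of_equivalent heq (c n)
    ⟨n, fun m hm => suffix_of_le h hm⟩
  have h1 : (c n).1 <:+ (c' (max N n)).1 := hN _ (le_max_left _ _)
  have h2 : (c' n).1 <:+ (c' (max N n)).1 := suffix_of_le h' (le_max_right _ _)
  refine eq_of_suffix_of_length_eq (List.suffix_or_suffix_of_suffix h1 h2) ?_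
  rw [length_chain h, length_chain h', h0, h0']

end Branch

end BranchTree

/-! ### Order preservation, reduced to paths with two edges -/

section EdgeOrder

variable {V : Type u} {W : Type v} {G : SimpleGraph V} {T : SimpleGraph W}

theorem FinSep.le_trans {s t w : FinSep G} (h : s ≤ t) (h' : t ≤ w) : s ≤ w :=
  ⟨h.1.trans h'.1, h'.2.trans h.2⟩

theorem FinSep.inv_le_inv {s t : FinSep G} (h : s ≤ t) : t.inv ≤ s.inv := ⟨h.2, h.1⟩

theorem map_le_of_consecutive (α : T.Dart → FinSep G)
    (h : ∀ (x y z : W) (hxy : T.Adj x y) (hyz : T.Adj y z), x ≠ z →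
      α ⟨(x, y), hxy⟩ ≤ α ⟨(y, z), hyz⟩) {d d' : T.Dart} (hd : EdgeLE d d') : α d ≤ α d' := by
  rcases hd with rfl | ⟨p, hp⟩
  · exact ⟨subset_rfl, subset_rfl⟩
  obtain ⟨⟨x, y⟩, hxy⟩ := d
  obtain ⟨⟨z, w⟩, hzw⟩ := d'
  simp only at p hp hxy hzw
  induction p generalizing x with
  | nil =>
    refine h _ _ _ hxy hzw ?_
    rintro rfl
    simp [Walk.concat_eq_append] at hp
  | @cons y y' z hyy' p ih =>
    rw [Walk.concat_cons] at hp
    refine FinSep.le_trans (h x y y' hxy hyy' ?_) (ih _ hyy' hzw hp.of_cons)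
    rintro rfl
    rw [Walk.cons_isPath_iff] at hp
    exact hp.2 (by simp)

end EdgeOrder

end InfGraph

namespace InfGraph

open SimpleGraph

/-! ### Parts, their children and the separations between them -/

section Display

variable {V : Type u} {G : SimpleGraph V}

/-- `C` is the vertex set of a component of `G - X` for some finite `X`, and some end in `Ψ` lives
in it. -/
def IsPart (Ψ : Set (GraphEnd G)) (C : Set V) : Prop :=
  (∃ (X : Finset V) (K : G.ComponentCompl (X : Set V)), (K : Set V) = C) ∧
    ∃ ω ∈ Ψ, ω.LivesIn C

/-- `D` is a component of `G - S C` contained in `C` in which some end in `Ψ` lives. -/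
def IsChildPart (Ψ : Set (GraphEnd G)) (S : Set V → Finset V) (C D : Set V) : Prop :=
  (∃ K : G.ComponentCompl (S C : Set V), (K : Set V) = D) ∧ D ⊆ C ∧ ∃ ω ∈ Ψ, ω.LivesIn D

/-- For every part `C` the finite set `S C` is connected, and it separates, inside `C`, the
complement of `C` from all ends in `Ψ` that live in `C`. -/
def IsSeparatorChoice (Ψ : Set (GraphEnd G)) (S : Set V → Finset V) : Prop :=
  ∀ C, IsPart Ψ C → (S C : Set V) ⊆ C ∧ (G.induce (S C : Set V)).Connected ∧
    ∀ ω ∈ Ψ, ω.LivesIn C → ∃ D, IsChildPart Ψ S C D ∧ ω.LivesIn D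

variable {Ψ : Set (GraphEnd G)} {S : Set V → Finset V}

theorem exists_isSeparatorChoice (hcpt : IsCompact Ψ) (hund : ∀ ω ∈ Ψ, ω.Undominated) :
    ∃ S : Set V → Finset V, IsSeparatorChoice Ψ S := by
  have h : ∀ C, ∃ S : Finset V, IsPart Ψ C → (S : Set V) ⊆ C ∧
      (G.induce (S : Set V)).Connected ∧ ∀ ω ∈ Ψ, ω.LivesIn C →
        ∃ D : G.ComponentCompl (S : Set V), (D : Set V) ⊆ C ∧ ω.LivesIn (D : Set V) := by
    intro C
    by_cases hC : IsPart Ψ C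
    · obtain ⟨⟨X, K, rfl⟩, -⟩ := hC
      obtain ⟨S, hS⟩ := exists_connected_finset_separating hcpt hund K
      exact ⟨S, fun _ => hS⟩
    · exact ⟨∅, fun h => absurd h hC⟩
  choose S hS using h
  refine ⟨S, fun C hC => ⟨(hS C hC).1, (hS C hC).2.1, fun ω hω hωC => ?_⟩⟩
  obtain ⟨D, hD, hωD⟩ := (hS C hC).2.2 ω hω hωC
  exact ⟨D, ⟨⟨D, rfl⟩, hD, ω, hω, hωD⟩, hωD⟩

theorem IsChildPart.isPart {C D : Set V} (h : IsChildPart Ψ S C D) : IsPart Ψ D :=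
  ⟨⟨S C, h.1⟩, h.2.2⟩

theorem IsChildPart.disjoint_separator {C D : Set V} (h : IsChildPart Ψ S C D) :
    Disjoint (S C : Set V) D := by
  obtain ⟨⟨K, rfl⟩, -⟩ := h
  exact K.disjoint_right

theorem IsChildPart.eq_of_mem {C D E : Set V} (h : IsChildPart Ψ S C D)
    (h' : IsChildPart Ψ S C E) {v : V} (hD : v ∈ D) (hE : v ∈ E) : D = E := by
  obtain ⟨⟨K, rfl⟩, -⟩ := h
  obtain ⟨⟨L, rfl⟩, -⟩ := h'
  by_contra hne
  exact Set.disjoint_iff.mp (ComponentCompl.pairwise_disjoint fun h => hne (by rw [h])) ⟨hD, hE⟩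

theorem finite_setOf_isChildPart (hcpt : IsCompact Ψ) (C : Set V) :
    {D | IsChildPart Ψ S C D}.Finite := by
  refine ((finite_setOf_component_livesIn hcpt (S C)).image
    fun K : G.ComponentCompl (S C : Set V) => (K : Set V)).subset ?_
  rintro D ⟨⟨K, rfl⟩, -, h⟩
  exact ⟨K, h, rfl⟩

/-- The separation that splits the children of the part `C` off the rest of the graph. -/
def partSep (Ψ : Set (GraphEnd G)) (S : Set V → Finset V) (C : Set V) : FinSep G where
  A := (⋃₀ {D | IsChildPart Ψ S C D})ᶜ
  B := S C ∪ ⋃₀ {D | IsChildPart Ψ S C D}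
  union_eq := by
    ext x
    simp only [Set.mem_union, Set.mem_compl_iff, Set.mem_univ, iff_true]
    tauto
  no_edge := by
    rintro a ⟨haA, haB⟩ b ⟨hbB, hbA⟩ hab
    obtain ⟨D, hD, hbD⟩ := not_not.mp hbA
    obtain ⟨⟨K, rfl⟩, -⟩ := id hD
    exact haA ⟨K, hD, ComponentCompl.mem_of_adj b a hbD (fun h => haB (Or.inl h)) hab.symm⟩
  finite_order := (S C).finite_toSet.subset fun x hx => hx.2.resolve_right hx.1

theorem partSep_separator (C : Set V) : (partSep Ψ S C).separator = S C := by
  refine Set.Subset.antisymm (fun x hx => hx.2.resolve_right hx.1) fun x hx =>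
    ⟨?_, Or.inl hx⟩
  rintro ⟨D, hD, hxD⟩
  exact Set.disjoint_left.mp hD.disjoint_separator hx hxD

theorem IsChildPart.subset_partSep {C D : Set V} (h : IsChildPart Ψ S C D) :
    D ⊆ (partSep Ψ S C).B := fun _ hx => Or.inr ⟨D, h, hx⟩

theorem partSep_subset (hS : IsSeparatorChoice Ψ S) {C : Set V} (hC : IsPart Ψ C) :
    (partSep Ψ S C).B ⊆ C := by
  rintro x (hx | ⟨D, hD, hx⟩)
  · exact (hS C hC).1 hx
  · exact hD.2.1 hx

theorem compl_partSep_subset {C : Set V} : (partSep Ψ S C).Aᶜ ⊆ C := by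
  intro x hx
  obtain ⟨D, hD, hx⟩ := not_not.mp hx
  exact hD.2.1 hx

/-- Everything split off at `D` lies in `D`, and `D` is among the children split off at `C`. -/
theorem IsChildPart.partSep_le (hS : IsSeparatorChoice Ψ S) {C D : Set V}
    (h : IsChildPart Ψ S C D) : partSep Ψ S C ≤ partSep Ψ S D := by
  refine ⟨?_, (partSep_subset hS h.isPart).trans h.subset_partSep⟩
  rw [← Set.compl_subset_compl]
  refine compl_partSep_subset.trans fun x hx => ?_
  exact not_not.mpr ⟨D, h, hx⟩

theorem IsChildPart.partSep_inv_le (hS : IsSeparatorChoice Ψ S) {C D E : Set V}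
    (hD : IsChildPart Ψ S C D) (hE : IsChildPart Ψ S C E) (hne : D ≠ E) :
    (partSep Ψ S D).inv ≤ partSep Ψ S E := by
  have key : ∀ {D E : Set V}, IsChildPart Ψ S C D → IsChildPart Ψ S C E → D ≠ E →
      (partSep Ψ S D).B ⊆ (partSep Ψ S E).A := by
    intro D E hD hE hne x hx
    by_contra hxA
    exact hne (hD.eq_of_mem hE (partSep_subset hS hD.isPart hx) (compl_partSep_subset hxA))
  exact ⟨key hD hE hne, key hE hD hne.symm⟩

/-! ### The decomposition tree and its branches -/

variable (Ψ S) in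
/-- The nodes of the decomposition tree. -/
abbrev PartNode : Type u := Branch (Set.univ : Set V) (IsChildPart Ψ S)

variable (Ψ S) in
/-- The decomposition tree. -/
abbrev partTree : SimpleGraph (PartNode Ψ S) := Branch.tree (Set.univ : Set V) (IsChildPart Ψ S)

theorem isPart_univ (hG : G.Connected) (hne : Ψ.Nonempty) : IsPart Ψ (Set.univ : Set V) := by
  obtain ⟨ω, hω⟩ := hne
  refine ⟨⟨∅, ?_⟩, ω, hω, fun R _ => ⟨0, fun m _ => Set.mem_univ _⟩⟩
  obtain ⟨v⟩ := hG.nonempty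
  refine ⟨G.componentComplMk (v := v) (by simp), ?_⟩
  refine Set.eq_univ_of_forall fun w => ?_
  obtain ⟨p⟩ := hG.preconnected v w
  have : ∀ (a b : V) (p : G.Walk a b) (C : G.ComponentCompl ((∅ : Finset V) : Set V)),
      a ∈ (C : Set V) → b ∈ (C : Set V) := by
    intro a b p C
    induction p with
    | nil => exact id
    | cons h p ih => exact fun ha => ih (ComponentCompl.mem_of_adj _ _ ha (by simp) h)
  exact this v w p _ (G.componentComplMk_mem _)

namespace PartNode

theorem isPart (huniv : IsPart Ψ (Set.univ : Set V)) (x : PartNode Ψ S) : IsPart Ψ x.top := by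
  rcases x.eq_root_or_exists_isParent with rfl | ⟨y, h⟩
  · exact huniv
  · exact h.child.isPart

theorem top_subset {x y : PartNode Ψ S} (h : x.1 <:+ y.1) : y.top ⊆ x.top := by
  induction y using Branch.induction_on with
  | h0 => exact fun _ _ => (Subtype.ext (List.suffix_nil.mp h) : x = Branch.root) ▸ Set.mem_univ _
  | h1 z y hzy ih =>
    rcases Branch.suffix_isParent hzy h with rfl | h
    · exact subset_rfl
    · exact hzy.child.2.1.trans (ih h)

/-- Siblings are disjoint, so parts that meet belong to comparable nodes. -/
theorem suffix_or_suffix {x y : PartNode Ψ S} {v : V} (hx : v ∈ x.top) (hy : v ∈ y.top) :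
    x.1 <:+ y.1 ∨ y.1 <:+ x.1 := by
  induction x using Branch.induction_on with
  | h0 => exact Or.inl List.nil_suffix
  | h1 z x h ih =>
    rcases ih (h.child.2.1 hx) with hzy | hyz
    · by_cases hne : z = y
      · exact Or.inr (hne ▸ h.suffix)
      · obtain ⟨w, hzw, hwy⟩ := Branch.exists_isParent_suffix hzy hne
        have hxw : x = w :=
          h.eq_of_top_eq hzw (h.child.eq_of_mem hzw.child hx (top_subset hwy hy))
        exact Or.inl (hxw ▸ hwy)
    · exact Or.inr (hyz.trans h.suffix)

theorem suffix_or_suffix_of_livesIn {x y : PartNode Ψ S} {ω : GraphEnd G}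
    (hx : ω.LivesIn x.top) (hy : ω.LivesIn y.top) : x.1 <:+ y.1 ∨ y.1 <:+ x.1 := by
  obtain ⟨v, hvx, hvy⟩ := (hx.inter hy).nonempty
  exact suffix_or_suffix hvx hvy

theorem disjoint_separator (hS : IsSeparatorChoice Ψ S) (huniv : IsPart Ψ (Set.univ : Set V))
    {x y : PartNode Ψ S} (hne : x ≠ y) : Disjoint (S x.top : Set V) (S y.top) := by
  have key : ∀ {x y : PartNode Ψ S} {v : V}, x ≠ y → v ∈ S x.top → v ∈ S y.top →
      ¬ x.1 <:+ y.1 := by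
    intro x y v hne hx hy hxy
    obtain ⟨w, hxw, hwy⟩ := Branch.exists_isParent_suffix hxy hne
    exact Set.disjoint_left.mp hxw.child.disjoint_separator hx
      (top_subset hwy ((hS _ (isPart huniv y)).1 hy))
  rw [Set.disjoint_left]
  intro v hx hy
  rcases suffix_or_suffix ((hS _ (isPart huniv x)).1 hx) ((hS _ (isPart huniv y)).1 hy) with h | h
  · exact key hne hx hy h
  · exact key hne.symm hy hx h

theorem end_unique (hG : G.Connected) (hS : IsSeparatorChoice Ψ S)
    (huniv : IsPart Ψ (Set.univ : Set V)) {c : ℕ → PartNode Ψ S}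
    (hc : ∀ n, (c n).IsParent (c (n + 1))) {ω ω' : GraphEnd G}
    (hω : ∀ n, ω.LivesIn (c n).top) (hω' : ∀ n, ω'.LivesIn (c n).top) : ω = ω' := by
  refine end_unique_of_iInter_empty (C := fun n => (c n).top)
    (fun n => (isPart huniv (c n)).1) (fun m n hmn => top_subset (Branch.suffix_of_le hc hmn))
    ?_ hω hω'
  by_contra! hcon
  obtain ⟨v, hv⟩ := hcon
  have hall : ∀ (a b : V) (p : G.Walk a b), (∀ n, a ∈ (c n).top) → ∀ n, b ∈ (c n).top := by
    intro a b p
    induction p with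
    | nil => exact id
    | @cons a b d hab p ih =>
      refine fun ha => ih fun n => ?_
      -- A neighbour of a vertex of the next part lies either in the separator or in that next part,
      -- and both are contained in the current part.
      by_cases hb : b ∈ S (c n).top
      · exact (hS _ (isPart huniv _)).1 hb
      · obtain ⟨⟨K, hK⟩, hsub, -⟩ := (hc n).child
        refine hsub (hK ▸ ComponentCompl.mem_of_adj a b (?_ : a ∈ (K : Set V)) hb hab)
        exact hK ▸ ha (n + 1)
  obtain ⟨w, hw⟩ := (hS _ (isPart huniv (c 0))).2.1.nonempty
  obtain ⟨p⟩ := hG.preconnected v w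
  exact Set.disjoint_left.mp (hc 0).child.disjoint_separator hw (hall v w p hv 1)

theorem exists_end (hcpt : IsCompact Ψ) (huniv : IsPart Ψ (Set.univ : Set V))
    {c : ℕ → PartNode Ψ S} (hc : ∀ n, (c n).IsParent (c (n + 1))) :
    ∃ ω ∈ Ψ, ∀ n, ω.LivesIn (c n).top :=
  exists_end_livesIn_chain hcpt (fun n => (c n).top) (fun n => (isPart huniv (c n)).1)
    (fun _ _ hmn => top_subset (Branch.suffix_of_le hc hmn)) fun n => (isPart huniv (c n)).2

theorem mem_of_livesIn_chain (hG : G.Connected) (hcpt : IsCompact Ψ)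
    (hS : IsSeparatorChoice Ψ S) (huniv : IsPart Ψ (Set.univ : Set V)) {c : ℕ → PartNode Ψ S}
    (hc : ∀ n, (c n).IsParent (c (n + 1))) {ω : GraphEnd G} (hω : ∀ n, ω.LivesIn (c n).top) :
    ω ∈ Ψ := by
  obtain ⟨ω', hω', h⟩ := exists_end hcpt huniv hc
  exact end_unique hG hS huniv hc hω h ▸ hω'

theorem exists_chain {P : PartNode Ψ S → Prop} (h0 : P Branch.root)
    (h1 : ∀ x, P x → ∃ y, x.IsParent y ∧ P y) :
    ∃ c : ℕ → PartNode Ψ S, c 0 = Branch.root ∧ (∀ n, (c n).IsParent (c (n + 1))) ∧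
      ∀ n, P (c n) := by
  choose f hf hPf using h1
  let g : ℕ → {x : PartNode Ψ S // P x} := fun n =>
    Nat.rec ⟨Branch.root, h0⟩ (fun _ x => ⟨f x.1 x.2, hPf x.1 x.2⟩) n
  exact ⟨fun n => (g n).1, rfl, fun n => hf (g n).1 (g n).2, fun n => (g n).2⟩

theorem exists_child_of_mem (hS : IsSeparatorChoice Ψ S) (huniv : IsPart Ψ (Set.univ : Set V))
    {ω : GraphEnd G} (hω : ω ∈ Ψ) (x : PartNode Ψ S) (hx : ω.LivesIn x.top) :
    ∃ y, x.IsParent y ∧ ω.LivesIn y.top := by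
  obtain ⟨D, hD, hωD⟩ := (hS _ (isPart huniv x)).2.2 ω hω hx
  obtain ⟨y, hy, rfl⟩ := Branch.exists_isParent_of_child hD
  exact ⟨y, hy, hωD⟩

theorem livesIn_partSep_of_mem (hS : IsSeparatorChoice Ψ S)
    (huniv : IsPart Ψ (Set.univ : Set V)) {ω : GraphEnd G} (hω : ω ∈ Ψ) {x : PartNode Ψ S}
    (hx : ω.LivesIn x.top) : ω.LivesIn (partSep Ψ S x.top).B := by
  obtain ⟨D, hD, hωD⟩ := (hS _ (isPart huniv x)).2.2 ω hω hx
  exact hωD.mono hD.subset_partSep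

end PartNode

/-! ### The tree of separations -/

open Classical in
/-- The separation associated with an oriented edge of the decomposition tree. -/
noncomputable def dartSep (d : (partTree Ψ S).Dart) : FinSep G :=
  if d.fst.IsParent d.snd then partSep Ψ S d.snd.top else (partSep Ψ S d.fst.top).inv

theorem dartSep_of_isParent {x y : PartNode Ψ S} (hxy : (partTree Ψ S).Adj x y)
    (h : x.IsParent y) : dartSep ⟨(x, y), hxy⟩ = partSep Ψ S y.top := if_pos h

theorem dartSep_of_isParent_symm {x y : PartNode Ψ S} (hxy : (partTree Ψ S).Adj x y)
    (h : y.IsParent x) : dartSep ⟨(x, y), hxy⟩ = (partSep Ψ S x.top).inv :=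
  if_neg fun h' => by
    have := h.length
    have := Branch.IsParent.length h'
    simp only at this
    omega

/-- The tree of separations on the decomposition tree. -/
noncomputable def partSepTree (hS : IsSeparatorChoice Ψ S) : FinSepTree G (partTree Ψ S) where
  isTree := Branch.tree_isTree
  α := dartSep
  map_symm := by
    rintro ⟨⟨x, y⟩, hxy⟩
    rcases id hxy with h | h
    · rw [dartSep_of_isParent hxy h]
      exact dartSep_of_isParent_symm hxy.symm h
    · rw [dartSep_of_isParent_symm hxy h]
      exact dartSep_of_isParent hxy.symm h
  map_le d d' hd := by
    refine map_le_of_consecutive dartSep (fun x y z hxy hyz hne => ?_) hd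
    rcases id hxy with h | h <;> rcases id hyz with h' | h'
    · rw [dartSep_of_isParent hxy h, dartSep_of_isParent hyz h']
      exact h'.child.partSep_le hS
    · exact absurd (h.unique h') hne
    · rw [dartSep_of_isParent_symm hxy h, dartSep_of_isParent hyz h']
      exact h.child.partSep_inv_le hS h'.child fun ht => hne (h.eq_of_top_eq h' ht)
    · rw [dartSep_of_isParent_symm hxy h, dartSep_of_isParent_symm hyz h']
      exact FinSep.inv_le_inv (h.child.partSep_le hS)

/-- Indexes each edge by its lower node, which determines the edge because parents are unique. -/
theorem exists_separator_eq (hS : IsSeparatorChoice Ψ S) (d : (partTree Ψ S).Dart) :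
    ∃ x y : PartNode Ψ S, x.IsParent y ∧ d.edge = s(x, y) ∧
      ((partSepTree hS).α d).separator = S y.top := by
  obtain ⟨⟨x, y⟩, hxy⟩ := d
  rcases id hxy with h | h
  · refine ⟨x, y, h, rfl, ?_⟩
    rw [← partSep_separator (Ψ := Ψ)]
    exact congrArg FinSep.separator (dartSep_of_isParent hxy h)
  · refine ⟨y, x, h, Sym2.eq_swap, ?_⟩
    rw [← partSep_separator (Ψ := Ψ), FinSep.separator, FinSep.separator, Set.inter_comm]
    exact congrArg (fun s => s.B ∩ s.A) (dartSep_of_isParent_symm hxy h)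

theorem partSepTree_isLocallyFinite (hcpt : IsCompact Ψ) (hS : IsSeparatorChoice Ψ S) :
    (partSepTree hS).IsLocallyFinite := by
  intro x
  have h1 : {y : PartNode Ψ S | x.IsParent y}.Finite := by
    refine Set.Finite.of_finite_image (f := Branch.top)
      ((finite_setOf_isChildPart (S := S) hcpt x.top).subset ?_) ?_
    · rintro _ ⟨y, hy, rfl⟩
      exact Branch.IsParent.child hy
    · intro y hy z hz h
      exact Branch.IsParent.eq_of_top_eq hy hz h
  have h2 : {y : PartNode Ψ S | y.IsParent x}.Finite :=
    Set.Subsingleton.finite fun y hy z hz => Branch.IsParent.unique hy hz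
  exact (h1.union h2).subset fun y hy => hy

theorem partSepTree_connectedSeparators (hS : IsSeparatorChoice Ψ S)
    (huniv : IsPart Ψ (Set.univ : Set V)) : (partSepTree hS).ConnectedSeparators := by
  intro d
  obtain ⟨x, y, -, -, h⟩ := exists_separator_eq hS d
  rw [h]
  exact (hS _ (PartNode.isPart huniv y)).2.1

theorem partSepTree_disjointSeparators (hS : IsSeparatorChoice Ψ S)
    (huniv : IsPart Ψ (Set.univ : Set V)) : (partSepTree hS).DisjointSeparators := by
  intro d d' hne
  obtain ⟨x, y, hxy, hd, h⟩ := exists_separator_eq hS d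
  obtain ⟨x', y', hxy', hd', h'⟩ := exists_separator_eq hS d'
  rw [h, h']
  refine PartNode.disjoint_separator hS huniv ?_
  rintro rfl
  exact hne (by rw [hd, hd', hxy.unique hxy'])

/-! ### How ends orient the tree, and the display of `Ψ` -/

theorem orients_of_isParent (hS : IsSeparatorChoice Ψ S) {x y : PartNode Ψ S}
    (hxy : (partTree Ψ S).Adj x y) (h : x.IsParent y) (ω : GraphEnd G) :
    (partSepTree hS).Orients ω ⟨(x, y), hxy⟩ ↔ ω.LivesIn (partSep Ψ S y.top).B := by
  rw [← dartSep_of_isParent hxy h]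
  rfl

theorem orients_of_isParent_symm (hS : IsSeparatorChoice Ψ S) {x y : PartNode Ψ S}
    (hxy : (partTree Ψ S).Adj x y) (h : y.IsParent x) (ω : GraphEnd G) :
    (partSepTree hS).Orients ω ⟨(x, y), hxy⟩ ↔ ω.LivesIn (partSep Ψ S x.top).A := by
  change _ ↔ ω.LivesIn (partSep Ψ S x.top).inv.B
  rw [← dartSep_of_isParent_symm hxy h]
  rfl

theorem livesAt_iff (hS : IsSeparatorChoice Ψ S) (ω : GraphEnd G) (t : PartNode Ψ S) :
    (partSepTree hS).LivesAt ω t ↔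
      (∀ x : PartNode Ψ S, x.IsParent t → ω.LivesIn (partSep Ψ S t.top).B) ∧
        ∀ y : PartNode Ψ S, t.IsParent y → ω.LivesIn (partSep Ψ S y.top).A := by
  constructor
  · intro h
    exact ⟨fun x hx => (orients_of_isParent hS (Or.inl hx) hx ω).mp (h _ rfl),
      fun y hy => (orients_of_isParent_symm hS (Or.inr hy) hy ω).mp (h _ rfl)⟩
  · rintro ⟨h1, h2⟩ ⟨⟨x, y⟩, hxy⟩ rfl
    rcases id hxy with h | h
    · exact (orients_of_isParent hS hxy h ω).mpr (h1 x h)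
    · exact (orients_of_isParent_symm hS hxy h ω).mpr (h2 x h)

theorem livesIn_top_of_livesAt (hS : IsSeparatorChoice Ψ S)
    (huniv : IsPart Ψ (Set.univ : Set V)) {ω : GraphEnd G} {t : PartNode Ψ S}
    (h : (partSepTree hS).LivesAt ω t) : ω.LivesIn t.top := by
  rcases t.eq_root_or_exists_isParent with rfl | ⟨x, hx⟩
  · exact fun R _ => ⟨0, fun m _ => Set.mem_univ _⟩
  · exact (((livesAt_iff hS ω t).mp h).1 x hx).mono
      (partSep_subset hS (PartNode.isPart huniv t))

theorem not_livesAt_of_mem (hS : IsSeparatorChoice Ψ S) (huniv : IsPart Ψ (Set.univ : Set V))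
    {ω : GraphEnd G} (hω : ω ∈ Ψ) (t : PartNode Ψ S) : ¬ (partSepTree hS).LivesAt ω t := by
  intro h
  obtain ⟨y, hy, hωy⟩ := PartNode.exists_child_of_mem hS huniv hω t
    (livesIn_top_of_livesAt hS huniv h)
  exact FinSep.not_livesIn_both _ ω (((livesAt_iff hS ω t).mp h).2 y hy)
    (PartNode.livesIn_partSep_of_mem hS huniv hω hωy)

theorem livesAt_unique (hS : IsSeparatorChoice Ψ S) (huniv : IsPart Ψ (Set.univ : Set V))
    {ω : GraphEnd G} {t t' : PartNode Ψ S} (h : (partSepTree hS).LivesAt ω t)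
    (h' : (partSepTree hS).LivesAt ω t') : t = t' := by
  have key : ∀ {t t' : PartNode Ψ S}, (partSepTree hS).LivesAt ω t →
      (partSepTree hS).LivesAt ω t' → t.1 <:+ t'.1 → t = t' := by
    intro t t' h h' hsuf
    by_contra hne
    obtain ⟨y, hty, hyt'⟩ := Branch.exists_isParent_suffix hsuf hne
    -- The edge from `t` to `y` is oriented towards `t` by assumption. Living at `t'`, which is `y`
    -- or lies below it, forces the opposite orientation too.
    refine FinSep.not_livesIn_both _ ω (((livesAt_iff hS ω t).mp h).2 y hty) ?_
    by_cases hy : y = t'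
    · subst hy
      exact ((livesAt_iff hS ω y).mp h').1 t hty
    · obtain ⟨z, hyz, hzt'⟩ := Branch.exists_isParent_suffix hyt' hy
      exact (livesIn_top_of_livesAt hS huniv h').mono
        ((PartNode.top_subset hzt').trans hyz.child.subset_partSep)
  rcases PartNode.suffix_or_suffix_of_livesIn (livesIn_top_of_livesAt hS huniv h)
    (livesIn_top_of_livesAt hS huniv h') with hs | hs
  · exact key h h' hs
  · exact (key h' h hs).symm

theorem exists_livesAt_of_notMem (hG : G.Connected) (hcpt : IsCompact Ψ)
    (hS : IsSeparatorChoice Ψ S) (huniv : IsPart Ψ (Set.univ : Set V)) {ω : GraphEnd G}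
    (hω : ω ∉ Ψ) : ∃ t : PartNode Ψ S, (partSepTree hS).LivesAt ω t := by
  by_contra! hcon
  -- If `ω` lives at no node, every node that it enters has a child that it enters; the condition is
  -- vacuous at the root.
  obtain ⟨c, hc0, hc, hP⟩ := PartNode.exists_chain
    (P := fun t : PartNode Ψ S => ∀ x : PartNode Ψ S, x.IsParent t → ω.LivesIn (partSep Ψ S t.top).B)
    (fun x hx => absurd hx Branch.not_isParent_root) (fun t ht => by
      have := hcon t
      rw [livesAt_iff] at this
      by_contra! hchild
      refine this ⟨ht, fun y hy => ((partSep Ψ S y.top).livesIn_or ω).resolve_right fun hB => ?_⟩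
      obtain ⟨x, -, hx⟩ := hchild y hy
      exact hx hB)
  -- The root is skipped, since the condition there carries no information.
  refine hω (PartNode.mem_of_livesIn_chain hG hcpt hS huniv (c := fun n => c (n + 1))
    (fun n => hc (n + 1)) fun n => ?_)
  exact (hP (n + 1) (c n) (hc n)).mono (partSep_subset hS (PartNode.isPart huniv _))

theorem exists_chain_of_correspondsTo (hS : IsSeparatorChoice Ψ S)
    (huniv : IsPart Ψ (Set.univ : Set V)) {ω : GraphEnd G} {η : GraphEnd (partTree Ψ S)}
    (h : (partSepTree hS).CorrespondsTo ω η) :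
    ∃ R : Ray (partTree Ψ S), η.HasRay R ∧ (∀ n, (R.vert n).IsParent (R.vert (n + 1))) ∧
      ∀ n, ω.LivesIn (R.vert n).top := by
  obtain ⟨R, hR, hω⟩ := h
  obtain ⟨N, hN⟩ := Branch.ray_eventually_isParent R
  -- The orientation of an edge gives information on its lower end, hence the tail from `N + 1`
  -- instead of `N`.
  refine ⟨R.tail (N + 1), hR.tail (N + 1), fun n => hN (N + 1 + n) (by omega), fun n => ?_⟩
  have hp := hN (N + n) (by omega)
  have := (orients_of_isParent hS (R.adj (N + n)) hp ω).mp (hω (N + n))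
  rw [show N + n + 1 = N + 1 + n by omega] at this
  exact this.mono (partSep_subset hS (PartNode.isPart huniv _))

theorem correspondsTo_of_chain (hS : IsSeparatorChoice Ψ S)
    (huniv : IsPart Ψ (Set.univ : Set V)) {ω : GraphEnd G} (hω : ω ∈ Ψ)
    {η : GraphEnd (partTree Ψ S)} {R : Ray (partTree Ψ S)} (hR : η.HasRay R)
    (hpar : ∀ n, (R.vert n).IsParent (R.vert (n + 1))) (hlive : ∀ n, ω.LivesIn (R.vert n).top) :
    (partSepTree hS).CorrespondsTo ω η :=
  ⟨R, hR, fun n => (orients_of_isParent hS (R.adj n) (hpar n) ω).mpr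
    (PartNode.livesIn_partSep_of_mem hS huniv hω (hlive (n + 1)))⟩

theorem partSepTree_displays (hG : G.Connected) (hcpt : IsCompact Ψ)
    (hS : IsSeparatorChoice Ψ S) (huniv : IsPart Ψ (Set.univ : Set V)) :
    (partSepTree hS).Displays Ψ := by
  classical
  have hchain : ∀ ω : Ψ, ∃ c : ℕ → PartNode Ψ S, c 0 = Branch.root ∧
      (∀ n, (c n).IsParent (c (n + 1))) ∧ ∀ n, ω.1.LivesIn (c n).top := fun ω =>
    PartNode.exists_chain (P := fun x => ω.1.LivesIn x.top)
      (fun R _ => ⟨0, fun m _ => Set.mem_univ _⟩)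
      (PartNode.exists_child_of_mem hS huniv ω.2)
  choose c hc0 hcpar hclive using hchain
  have hnode : ∀ ω : {ω // ω ∉ Ψ}, ∃ t : PartNode Ψ S, (partSepTree hS).LivesAt ω.1 t :=
    fun ω => exists_livesAt_of_notMem hG hcpt hS huniv ω.2
  choose t ht using hnode
  let e : Ψ → GraphEnd (partTree Ψ S) := fun ω =>
    Quotient.mk (raySetoid (partTree Ψ S)) (Branch.rayOfChain (c ω) (hcpar ω))
  let τ : GraphEnd G → GraphEnd (partTree Ψ S) ⊕ PartNode Ψ S := fun ω =>
    if h : ω ∈ Ψ then Sum.inl (e ⟨ω, h⟩) else Sum.inr (t ⟨ω, h⟩)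
  have hτ : ∀ ω (h : ω ∈ Ψ), τ ω = Sum.inl (e ⟨ω, h⟩) := fun ω h => dif_pos h
  have hτ' : ∀ ω (h : ω ∉ Ψ), τ ω = Sum.inr (t ⟨ω, h⟩) := fun ω h => dif_neg h
  have hcorr : ∀ ω (h : ω ∈ Ψ) η, (partSepTree hS).CorrespondsTo ω η → e ⟨ω, h⟩ = η := by
    intro ω h η hη
    obtain ⟨R, hR, hpar, hlive⟩ := exists_chain_of_correspondsTo hS huniv hη
    rw [← hR]
    -- The chain of `ω` starts at the root and `R` at depth `(R.vert 0).1.length`; shifting by this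
    -- aligns nodes of equal depth.
    refine Quotient.sound (Ray.equivalent_of_eventually_eq (R.vert 0).1.length 0 fun k => ?_)
    refine Branch.eq_of_suffix_of_length_eq
      (PartNode.suffix_or_suffix_of_livesIn (hclive ⟨ω, h⟩ _) (hlive _)) ?_
    have h1 := Branch.length_chain (hcpar ⟨ω, h⟩) ((R.vert 0).1.length + k)
    rw [hc0] at h1
    refine h1.trans ?_
    have h2 := Branch.length_chain hpar (0 + k)
    refine Eq.trans ?_ h2.symm
    simp [Branch.root]
  refine ⟨τ, ⟨fun ω η => ?_, fun ω s => ?_⟩, ⟨?_, ?_, ?_⟩, fun ω h => ⟨_, (hτ' ω h).symm⟩⟩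
  · by_cases h : ω ∈ Ψ
    · rw [hτ ω h, Sum.inl.injEq]
      refine ⟨?_, hcorr ω h η⟩
      rintro rfl
      exact correspondsTo_of_chain hS huniv h rfl (hcpar ⟨ω, h⟩) (hclive ⟨ω, h⟩)
    · rw [hτ' ω h]
      refine iff_of_false Sum.inr_ne_inl fun hη => h ?_
      obtain ⟨R, -, hpar, hlive⟩ := exists_chain_of_correspondsTo hS huniv hη
      exact PartNode.mem_of_livesIn_chain hG hcpt hS huniv hpar hlive
  · by_cases h : ω ∈ Ψ
    · rw [hτ ω h]
      exact iff_of_false Sum.inl_ne_inr (not_livesAt_of_mem hS huniv h s)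
    · rw [hτ' ω h, Sum.inr.injEq]
      exact ⟨fun hs => hs ▸ ht ⟨ω, h⟩, fun hs => livesAt_unique hS huniv (ht ⟨ω, h⟩) hs⟩
  · exact fun ω h => ⟨_, (hτ ω h).symm⟩
  · intro ω h ω' h' heq
    rw [hτ ω h, hτ ω' h', Sum.inl.injEq] at heq
    have hcc := Branch.chain_eq_of_equivalent (hcpar ⟨ω, h⟩) (hcpar ⟨ω', h'⟩) (hc0 _) (hc0 _)
      (Quotient.exact heq)
    refine PartNode.end_unique hG hS huniv (hcpar ⟨ω, h⟩) (hclive ⟨ω, h⟩) ?_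
    rw [hcc]
    exact hclive ⟨ω', h'⟩
  · rintro _ ⟨η, rfl⟩
    obtain ⟨R, hR⟩ := η.exists_ray
    obtain ⟨N, hN⟩ := Branch.ray_eventually_isParent R
    have hpar : ∀ n, ((R.tail N).vert n).IsParent ((R.tail N).vert (n + 1)) :=
      fun n => hN (N + n) (by omega)
    obtain ⟨ω, hω, hlive⟩ := PartNode.exists_end hcpt huniv hpar
    refine ⟨ω, hω, ?_⟩
    rw [hτ ω hω, hcorr ω hω η (correspondsTo_of_chain hS huniv hω (hR.tail N) hpar hlive)]

end Display

end InfGraph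

theorem proposition4p4 {V : Type u} (G : SimpleGraph V) (hG : G.Connected)
    (Ψ : Set (InfGraph.GraphEnd G)) (hne : Ψ.Nonempty) (hcpt : IsCompact Ψ)
    (hund : ∀ ω ∈ Ψ, ω.Undominated) :
    ∃ (W : Type u) (T : SimpleGraph W) (𝒯 : InfGraph.FinSepTree G T),
      𝒯.IsLocallyFinite ∧ 𝒯.ConnectedSeparators ∧ 𝒯.DisjointSeparators ∧ 𝒯.Displays Ψ := by
  obtain ⟨S, hS⟩ := InfGraph.exists_isSeparatorChoice hcpt hund
  have huniv := InfGraph.isPart_univ hG hne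
  exact ⟨_, _, InfGraph.partSepTree hS, InfGraph.partSepTree_isLocallyFinite hcpt hS,
    InfGraph.partSepTree_connectedSeparators hS huniv,
    InfGraph.partSepTree_disjointSeparators hS huniv,
    InfGraph.partSepTree_displays hG hcpt hS huniv⟩
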